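/- All graphs are finite, undirected and simple. For a graph $G$ with $n$ vertices, let $A(G)$ be its adjacency matrix, $D(G)$ its diagonal degree matrix, $\kappa'(G)$ its edge connectivity, and for disjoint $X,Y\subseteq V(G)$ let $e(X,Y)$ be the number of edges with one end in $X$ and the other in $Y$. For a real symmetric matrix $M$ of order $n$ let $\lambda_i(M)$ be its $i$th largest eigenvalue, counted with multiplicity. Let $\mathcal G_2$ be the class of graphs $G$ that have three pairwise disjoint non-empty proper subsets $V_1,V_2,V_3$ of $V(G)$ with $V(G)\setminus(V_1\cup V_2\cup V_3)\neq\emptyset$ and $e(V_i,V(G)\setminus V_i)=\kappa'(G)$ for $i=1,2,3$. A graph $G$ has property $P(k,d)$ if it contains $k$ pairwise edge-disjoint spanning trees and a further forest $F$, edge-disjoint from these trees, with $|E(F)|>\frac{d-1}{d}(n-1)$, such that if $F$ is not a spanning tree, then $F$ has a component with at least $d$ edges. **Corollary 4.2.** Let $k\ge 2$ be an integer and let $G\in\mathcal G_2$ be a graph on $n$ vertices with minimum degree $\delta\ge 3k+3$. Then $G$ has property $P(k,\delta)$ if one of the following conditions holds for some real numbers $a,b$: 1. $a\ge -1$ and $\lambda_4(aD(G)+A(G))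 < (a+1)\delta-\dfrac{9\left(k+\frac{\delta-1}{\delta}\right)}{\delta+1}$; 2. $b>0$, $\frac ab\ge -1$ and $\lambda_4(aD(G)+bA(G)) < (a+b)\delta-\dfrac{9b\left(k+\frac{\delta-1}{\delta}\right)}{\delta+1}$; 3. $b<0$, $\frac ab\ge -1$ and $\lambda_{n-3}(aD(G)+bA(G)) > (a+b)\delta-\dfrac{9b\left(k+\frac{\delta-1}{\delta}\right)}{\delta+1}$. -/

import Mathlib

namespace TreePacking

/-- The `i`-th largest eigenvalue (counted with multiplicity, `i = 1, …, n`) of a real symmetric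
matrix of order `n`.  The value is `0` if `M` is not symmetric or `i` is out of range. -/
noncomputable def nthLargestEigenvalue {V : Type*} [Fintype V] [DecidableEq V]
    (M : Matrix V V ℝ) (i : ℕ) : ℝ :=
  open Classical in
  if h : M.IsHermitian ∧ 1 ≤ i ∧ i ≤ Fintype.card V then
    h.1.eigenvalues₀ ⟨i - 1, by omega⟩
  else 0

/-- The matrices `a D(G) + b A(G)` are symmetric, so their eigenvalues above are the genuine ones. -/
theorem isHermitian_smul_degMatrix_add {V : Type*} [Fintype V] [DecidableEq V]
    (G : SimpleGraph V) [DecidableRel G.Adj] (a b : ℝ) :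
    (a • G.degMatrix ℝ + b • G.adjMatrix ℝ).IsHermitian := by
  ext i j
  have h1 := congrFun (congrFun (G.isSymm_degMatrix (R := ℝ)) i) j
  simp only [Matrix.transpose_apply] at h1
  simp [Matrix.conjTranspose_apply, h1, G.adj_comm j i]

/-- The edge connectivity `κ'(G)`: the least number of edges whose deletion leaves a graph that is
not connected (`0` if `G` is not connected; also `0` for the one-vertex graph). -/
noncomputable def edgeConnectivity {V : Type*} (G : SimpleGraph V) : ℕ :=
  sInf {m : ℕ | ∃ X : Finset (Sym2 V), (X : Set (Sym2 V)) ⊆ G.edgeSet ∧ X.card = m ∧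
    ¬ (G.deleteEdges (X : Set (Sym2 V))).Connected}

/-- `e(X, Y)`: the number of edges of `G` with one end in `X` and the other end in `Y`,
for disjoint `X` and `Y`. -/
def edgesBetween {V : Type*} (G : SimpleGraph V) [DecidableRel G.Adj] (X Y : Finset V) : ℕ :=
  (G.interedges X Y).card

/-- Membership in the class `𝒢_t`: there are `t + 1` pairwise disjoint non-empty proper vertex
subsets, not covering all vertices, each of whose edge boundaries has exactly `κ'(G)` edges. -/
def InClass {V : Type*} [Fintype V] [DecidableEq V] (t : ℕ) (G : SimpleGraph V)
    [DecidableRel G.Adj] : Prop :=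
  ∃ U : Fin (t + 1) → Finset V,
    (∀ i, (U i).Nonempty) ∧
    (∀ i, U i ≠ Finset.univ) ∧
    (∀ i j, i ≠ j → Disjoint (U i) (U j)) ∧
    (Finset.univ \ Finset.univ.biUnion U).Nonempty ∧
    (∀ i, edgeConnectivity G = edgesBetween G (U i) (Finset.univ \ U i))

/-- The property `P(k, d)`: `G` contains `k` pairwise edge-disjoint spanning trees `T i` and a
further forest `F`, edge-disjoint from all of them, with more than `(d - 1) / d * (n - 1)` edges,
such that if `F` is not a spanning tree then some component of `F` has at least `d` edges.
Trees and forests are subgraphs of `G` on the whole vertex set. -/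
def PropertyP {V : Type*} [Fintype V] (k d : ℕ) (G : SimpleGraph V) : Prop :=
  ∃ (T : Fin k → SimpleGraph V) (F : SimpleGraph V),
    (∀ i, T i ≤ G ∧ (T i).IsTree) ∧
    (∀ i j, i ≠ j → Disjoint (T i).edgeSet (T j).edgeSet) ∧
    F ≤ G ∧ F.IsAcyclic ∧
    (∀ i, Disjoint (T i).edgeSet F.edgeSet) ∧
    ((d : ℝ) - 1) / d * ((Fintype.card V : ℝ) - 1) < (F.edgeSet.ncard : ℝ) ∧
    (¬ F.IsTree → ∃ c : F.ConnectedComponent,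
      d ≤ {e ∈ F.edgeSet | ∀ v ∈ e, v ∈ c.supp}.ncard)

end TreePacking

/-!
# Spanning tree packings from the fourth eigenvalue

Each of the three eigenvalue conditions yields `k + 1` edge-disjoint spanning trees. This is more
than the property `P(k, δ)` asks for, since the last tree can serve as the forest.

For `a + b` and `b` of the same sign the quadratic form of `a D + b A` is a multiple of the form of
`D`, which is at least `δ` times the identity, minus `b` times the form of the Laplacian. If four
disjoint sets of at least `δ` vertices have small edge boundaries, the Laplacian form is small on
the span of their indicator functions, and the minimax principle contradicts the bound on the fourth
largest (or smallest) eigenvalue. Hence there are no four such sets (`noFourSmallCuts_of_pos`,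
`noFourSmallCuts_of_neg`). The bound on the Laplacian form weights the sets
(`laplacian_sum_smul_indicatorVec_le`): equal weights suit four sets with similar cuts, while three
minimum cuts and the set of all other vertices need the weights of a star.

By the theorem of Nash-Williams and Tutte (`exists_disjoint_spanning_trees`) it remains to show
that a partition into `s` parts is crossed by at least `(k + 1) (s - 1)` edges
(`NoFourSmallCuts.succ_mul_le`). This is clear if the edge connectivity `κ'` is at least
`2 k + 2`. Otherwise the three given minimum cuts have more than `δ` vertices, so that the set of the
remaining vertices is small, hence a single vertex `v`, and `3 κ' ≥ deg v ≥ 3 k + 3`. At most three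
parts of the partition have at most `3 k + 2` boundary edges; counting boundaries settles all cases
but that of exactly three parts, all of them with small boundaries. Then the parts meet the three
minimum cuts in a matching (`NoFourSmallCuts.exists_injective`), and uncrossing turns them into the
three minimum cuts, one of them enlarged by `v`, without increasing the number of crossing edges
(`minDegree_add_edgeConnectivity_le_sum_cut`).

The proof of the Nash-Williams–Tutte theorem takes a partial colouring of the edges whose colour
classes are forests and which leaves as few edges as possible uncoloured. The edges that can be
uncoloured by exchanges form a graph which each colour class spans by its own such edges
(`reachable_of_mem_exchangeable`), and the components of this graph are the parts of a partition on
which the counting is tight.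
-/

namespace TreePacking

open SimpleGraph

/-! ### Counting edges of graphs and forests -/

theorem card_le_ncard_edgeSet_add_card_connectedComponent {V : Type*} [Finite V]
    (G : SimpleGraph V) :
    Nat.card V ≤ G.edgeSet.ncard + Nat.card G.ConnectedComponent := by
  rcases isEmpty_or_nonempty V with hV | ⟨⟨r⟩⟩
  · simp
  -- Joining a root to one vertex of every other component makes the graph connected.
  set S : Set (Sym2 V) :=
    (fun c : G.ConnectedComponent => s(r, c.out)) '' {G.connectedComponentMk r}ᶜ with hS
  have hconn : (G ⊔ fromEdgeSet S).Connected := by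
    rw [connected_iff_exists_forall_reachable]
    refine ⟨r, fun w => ?_⟩
    have hw : (G ⊔ fromEdgeSet S).Reachable (G.connectedComponentMk w).out w :=
      (ConnectedComponent.exact (Quot.out_eq (G.connectedComponentMk w))).mono le_sup_left
    by_cases h : G.connectedComponentMk w = G.connectedComponentMk r
    · exact (ConnectedComponent.exact h.symm).mono le_sup_left
    · by_cases h' : r = (G.connectedComponentMk w).out
      · rwa [← h'] at hw
      · refine Reachable.trans (Adj.reachable ?_) hw
        rw [sup_adj, fromEdgeSet_adj]
        exact Or.inr ⟨⟨_, h, rfl⟩, h'⟩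
  have h1 := hconn.card_vert_le_card_edgeSet_add_one
  have h2 : (G ⊔ fromEdgeSet S).edgeSet.ncard ≤ G.edgeSet.ncard + S.ncard := by
    refine (Set.ncard_le_ncard ?_ (Set.toFinite _)).trans (Set.ncard_union_le _ _)
    rw [edgeSet_sup, edgeSet_fromEdgeSet]
    exact Set.union_subset_union_right _ Set.sdiff_subset
  have h3 : S.ncard ≤ ({G.connectedComponentMk r}ᶜ : Set G.ConnectedComponent).ncard :=
    Set.ncard_image_le (Set.toFinite _)
  have h4 := Set.ncard_add_ncard_compl {G.connectedComponentMk r}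
  rw [Set.ncard_singleton] at h4
  rw [Nat.card_coe_set_eq] at h1
  omega

theorem ncard_edgeSet_add_one_le_of_isAcyclic {V : Type*} [Finite V] [Nonempty V]
    {F : SimpleGraph V} (hF : F.IsAcyclic) : F.edgeSet.ncard + 1 ≤ Nat.card V := by
  obtain ⟨T, hFT, -, hT⟩ := connected_top.exists_isTree_le_of_le_of_isAcyclic le_top hF
  have h := (isTree_iff_connected_and_card.1 hT).2
  rw [Nat.card_coe_set_eq] at h
  have := Set.ncard_le_ncard (edgeSet_mono hFT) (Set.toFinite _)
  omega

theorem isTree_of_isAcyclic_of_card_le {V : Type*} [Finite V] [Nonempty V]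
    {F : SimpleGraph V} (hF : F.IsAcyclic) (h : Nat.card V ≤ F.edgeSet.ncard + 1) :
    F.IsTree := by
  obtain ⟨T, hFT, -, hT⟩ := connected_top.exists_isTree_le_of_le_of_isAcyclic le_top hF
  have h' := (isTree_iff_connected_and_card.1 hT).2
  rw [Nat.card_coe_set_eq] at h'
  have := Set.eq_of_subset_of_ncard_le (edgeSet_mono hFT) (by omega) (Set.toFinite _)
  rwa [edgeSet_inj.1 this]

/-! ### The tree packing theorem of Nash-Williams and Tutte -/

/-- The edges of `G` of colour `i`, for a partial edge colouring `c` (`none` means uncoloured). -/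
def colorClass {V ι : Type*} (G : SimpleGraph V) (c : Sym2 V → Option ι) (i : ι) :
    SimpleGraph V :=
  G ⊓ fromEdgeSet {e | c e = some i}

/-- The edges of `G` which the partial colouring `c` leaves uncoloured. -/
def uncolored {V ι : Type*} (G : SimpleGraph V) (c : Sym2 V → Option ι) : Set (Sym2 V) :=
  {e ∈ G.edgeSet | c e = none}

/-- The edges of `G` whose ends have different labels under `f`. -/
def crossing {V κ : Type*} (G : SimpleGraph V) (f : V → κ) : SimpleGraph V where
  Adj u v := G.Adj u v ∧ f u ≠ f v
  symm := ⟨fun _ _ h => ⟨h.1.symm, h.2.symm⟩⟩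
  loopless := ⟨fun _ h => h.2 rfl⟩

theorem mem_edgeSet_colorClass {V ι : Type*} {G : SimpleGraph V} {c : Sym2 V → Option ι} {i : ι}
    {e : Sym2 V} : e ∈ (colorClass G c i).edgeSet ↔ e ∈ G.edgeSet ∧ c e = some i := by
  rw [colorClass, edgeSet_inf, edgeSet_fromEdgeSet]
  constructor
  · rintro ⟨h, h', -⟩
    exact ⟨h, h'⟩
  · rintro ⟨h, h'⟩
    exact ⟨h, h', G.not_isDiag_of_mem_edgeSet h⟩

theorem colorClass_adj {V ι : Type*} {G : SimpleGraph V} {c : Sym2 V → Option ι} {i : ι}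
    {u v : V} : (colorClass G c i).Adj u v ↔ G.Adj u v ∧ c s(u, v) = some i := by
  rw [← mem_edgeSet, mem_edgeSet_colorClass, mem_edgeSet]

/-- A partial colouring `c'` arises from `c` by an exchange if an uncoloured edge gets the colour of
some edge, which loses its colour, so that all colour classes of `c'` are forests. -/
def Exchange {V ι : Type*} [DecidableEq V] (G : SimpleGraph V) (c c' : Sym2 V → Option ι) : Prop :=
  (∀ i, (colorClass G c' i).IsAcyclic) ∧
    ∃ i, ∃ e ∈ uncolored G c, ∃ f ∈ (colorClass G c i).edgeSet,
      c' = Function.update (Function.update c e (some i)) f none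

theorem Exchange.uncolored_ncard_le {V ι : Type*} [Finite V] [DecidableEq V] {G : SimpleGraph V}
    {c c' : Sym2 V → Option ι} (h : Exchange G c c') :
    (uncolored G c').ncard ≤ (uncolored G c).ncard := by
  obtain ⟨-, i, e, he, f, hf, rfl⟩ := h
  have hsub : uncolored G (Function.update (Function.update c e (some i)) f none) ⊆
      insert f (uncolored G c \ {e}) := by
    rintro g ⟨hg, hg'⟩
    by_cases hgf : g = f
    · exact Or.inl hgf
    · rw [Function.update_of_ne hgf] at hg'
      by_cases hge : g = e
      · simp [hge] at hg'
      · rw [Function.update_of_ne hge] at hg'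
        exact Or.inr ⟨⟨hg, hg'⟩, hge⟩
  have h1 := Set.ncard_le_ncard hsub (Set.toFinite _)
  have h2 := Set.ncard_insert_le f (uncolored G c \ {e})
  have h3 := Set.ncard_sdiff_singleton_add_one he (Set.toFinite _)
  omega

theorem colorClass_update_none_le {V ι : Type*} [DecidableEq V] (G : SimpleGraph V)
    (c : Sym2 V → Option ι) (e : Sym2 V) (i : ι) :
    colorClass G (Function.update c e none) i ≤ (colorClass G c i).deleteEdges {e} := by
  intro u v h
  rw [colorClass_adj] at h
  rw [deleteEdges_adj, colorClass_adj]
  by_cases he : s(u, v) = e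
  · simp [he] at h
  · rw [Function.update_of_ne he] at h
    exact ⟨h, he⟩

theorem colorClass_update_some_le {V ι : Type*} [DecidableEq V] (G : SimpleGraph V)
    (c : Sym2 V → Option ι) (x y : V) (i : ι) :
    colorClass G (Function.update c s(x, y) (some i)) i ≤ colorClass G c i ⊔ edge x y := by
  intro u v h
  rw [colorClass_adj] at h
  rw [sup_adj, colorClass_adj]
  by_cases he : s(u, v) = s(x, y)
  · right
    rw [edge, fromEdgeSet_adj]
    exact ⟨he, h.1.ne⟩
  · rw [Function.update_of_ne he] at h
    exact Or.inl h

theorem colorClass_update_some_le_of_ne {V ι : Type*} [DecidableEq V] (G : SimpleGraph V)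
    (c : Sym2 V → Option ι) (e : Sym2 V) {i j : ι} (hij : i ≠ j) :
    colorClass G (Function.update c e (some i)) j ≤ colorClass G c j := by
  intro u v h
  rw [colorClass_adj] at h ⊢
  by_cases he : s(u, v) = e
  · simp [he, hij] at h
  · rwa [Function.update_of_ne he] at h

/-- Deleting an edge of the path from `x` to `y` in a forest separates `x` from `y`, so that the edge
`xy` can then be added without closing a cycle. -/
theorem not_reachable_deleteEdges_of_mem_path {V : Type*} {F : SimpleGraph V} (hF : F.IsAcyclic)
    {x y : V} {p : F.Walk x y} (hp : p.IsPath) {f : Sym2 V} (hf : f ∈ p.edges) :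
    ¬ (F.deleteEdges {f}).Reachable x y := by
  intro h
  obtain ⟨q, hq⟩ := h.exists_isPath
  have hle : F.deleteEdges {f} ≤ F := deleteEdges_le _
  have heq := (hF.subsingleton_path x y).elim ⟨p, hp⟩ ⟨q.mapLe hle, hq.mapLe hle⟩
  have hpq : p = q.mapLe hle := congrArg Subtype.val heq
  rw [hpq, Walk.edges_mapLe_eq_edges] at hf
  have := q.edges_subset_edgeSet hf
  rw [edgeSet_deleteEdges] at this
  exact this.2 rfl

/-- The edges of `G` which can be left uncoloured after a series of exchanges starting at `c₀`. -/
def exchangeable {V ι : Type*} [DecidableEq V] (G : SimpleGraph V) (c₀ : Sym2 V → Option ι) :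
    Set (Sym2 V) :=
  {e | ∃ c, Relation.ReflTransGen (Exchange G) c₀ c ∧ e ∈ uncolored G c}

section Exchange

variable {V ι : Type*} [Finite V] [DecidableEq V] {G : SimpleGraph V} {c₀ : Sym2 V → Option ι}

/-- If no partial colouring into forests leaves fewer edges uncoloured than `c`, then the ends of an
uncoloured edge are joined in every colour class by a path all of whose edges can be exchanged
for that edge. -/
theorem reachable_of_mem_uncolored (h₀ : ∀ i, (colorClass G c₀ i).IsAcyclic)
    (hopt : ∀ c : Sym2 V → Option ι, (∀ i, (colorClass G c i).IsAcyclic) →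
      (uncolored G c₀).ncard ≤ (uncolored G c).ncard)
    {c : Sym2 V → Option ι} (hc : Relation.ReflTransGen (Exchange G) c₀ c) {x y : V}
    (hxy : s(x, y) ∈ uncolored G c) (i : ι) :
    (colorClass G c i ⊓ fromEdgeSet (exchangeable G c₀)).Reachable x y := by
  have hacyc : ∀ j, (colorClass G c j).IsAcyclic := by
    rcases Relation.ReflTransGen.cases_tail hc with rfl | ⟨c', -, h⟩
    · exact h₀
    · exact h.1
  have hle : (uncolored G c).ncard ≤ (uncolored G c₀).ncard := by
    clear hxy hacyc
    induction hc with
    | refl => exact le_rfl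
    | tail _ h ih => exact h.uncolored_ncard_le.trans ih
  have hreach : (colorClass G c i).Reachable x y := by
    by_contra hn
    have h1 := hopt (Function.update c s(x, y) (some i)) (fun j => by
      by_cases hij : i = j
      · subst hij
        exact ((hacyc i).sup_edge_of_not_reachable hn).anti (colorClass_update_some_le G c x y i)
      · exact (hacyc j).anti (colorClass_update_some_le_of_ne G c _ hij))
    have h2 : uncolored G (Function.update c s(x, y) (some i)) ⊆ uncolored G c \ {s(x, y)} := by
      rintro g ⟨hg, hg'⟩
      by_cases hge : g = s(x, y)
      · simp [hge] at hg'
      · rw [Function.update_of_ne hge] at hg'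
        exact ⟨⟨hg, hg'⟩, hge⟩
    have h3 := Set.ncard_le_ncard h2 (Set.toFinite _)
    have h4 := Set.ncard_sdiff_singleton_add_one hxy (Set.toFinite _)
    omega
  obtain ⟨p, hp⟩ := hreach.exists_isPath
  refine ⟨p.transfer _ fun f hf => ?_⟩
  have hfc := p.edges_subset_edgeSet hf
  rw [edgeSet_inf, edgeSet_fromEdgeSet]
  refine ⟨hfc, ?_, (colorClass G c i).not_isDiag_of_mem_edgeSet hfc⟩
  refine ⟨Function.update (Function.update c s(x, y) (some i)) f none, hc.tail ⟨fun j => ?_, i, _,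
    hxy, f, hfc, rfl⟩, (mem_edgeSet_colorClass.1 hfc).1, by simp⟩
  by_cases hij : i = j
  · subst hij
    have hn := not_reachable_deleteEdges_of_mem_path (hacyc i) hp hf
    refine (((hacyc i).anti (deleteEdges_le {f})).sup_edge_of_not_reachable hn).anti ?_
    refine (colorClass_update_none_le G _ f i).trans ?_
    intro u v h
    rw [deleteEdges_adj] at h
    rcases colorClass_update_some_le G c x y i h.1 with h' | h'
    · exact Or.inl (deleteEdges_adj.2 ⟨h', h.2⟩)
    · exact Or.inr h'
  · exact (hacyc j).anti ((colorClass_update_none_le G _ f j).trans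
      ((deleteEdges_le _).trans (colorClass_update_some_le_of_ne G c _ hij)))

/-- Each colour class of an optimal colouring `c₀` spans the graph of exchangeable edges by its own
exchangeable edges. -/
theorem reachable_of_mem_exchangeable (h₀ : ∀ i, (colorClass G c₀ i).IsAcyclic)
    (hopt : ∀ c : Sym2 V → Option ι, (∀ i, (colorClass G c i).IsAcyclic) →
      (uncolored G c₀).ncard ≤ (uncolored G c).ncard)
    {x y : V} (hxy : s(x, y) ∈ exchangeable G c₀) (i : ι) :
    (colorClass G c₀ i ⊓ fromEdgeSet (exchangeable G c₀)).Reachable x y := by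
  obtain ⟨c, hc, hxy⟩ := hxy
  have h := reachable_of_mem_uncolored h₀ hopt hc hxy i
  clear hxy
  induction hc with
  | refl => exact h
  | @tail c c' hc hcc' ih =>
    apply ih
    -- Only one edge of the new colour class is missing in the old one, and its ends are joined.
    rw [reachable_iff_reflTransGen] at h
    refine Relation.ReflTransGen.rec Reachable.rfl (fun {u v} _ huv hru => hru.trans ?_) h
    obtain ⟨-, j, e, he, f, hf, rfl⟩ := hcc'
    obtain ⟨huv1, huv2⟩ := huv
    rw [colorClass_adj] at huv1
    have hne : s(u, v) ≠ f := by
      rintro rfl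
      simp at huv1
    rw [Function.update_of_ne hne] at huv1
    by_cases hue : s(u, v) = e
    · subst hue
      exact reachable_of_mem_uncolored h₀ hopt hc he i
    · rw [Function.update_of_ne hue] at huv1
      exact Adj.reachable ⟨colorClass_adj.2 huv1, huv2⟩

end Exchange

/-- The theorem of Nash-Williams and Tutte: if for every partition of the vertices into `s`
non-empty parts at least `k (s - 1)` edges join different parts, then `G` contains `k`
edge-disjoint spanning trees. -/
theorem exists_disjoint_spanning_trees {V : Type*} [Finite V] [Nonempty V] (G : SimpleGraph V)
    (k : ℕ) (h : ∀ (s : ℕ) (f : V → Fin s), Function.Surjective f →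
      k * s ≤ (crossing G f).edgeSet.ncard + k) :
    ∃ T : Fin k → SimpleGraph V, (∀ i, T i ≤ G ∧ (T i).IsTree) ∧
      ∀ i j, i ≠ j → Disjoint (T i).edgeSet (T j).edgeSet := by
  classical
  obtain ⟨c₀, h₀, hopt⟩ : ∃ c₀ : Sym2 V → Option (Fin k),
      (∀ i, (colorClass G c₀ i).IsAcyclic) ∧
      ∀ c : Sym2 V → Option (Fin k), (∀ i, (colorClass G c i).IsAcyclic) →
        (uncolored G c₀).ncard ≤ (uncolored G c).ncard := by
    have hne : ∃ c : Sym2 V → Option (Fin k), ∀ i, (colorClass G c i).IsAcyclic := by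
      refine ⟨fun _ => none, fun i => isAcyclic_bot.anti fun u v huv => ?_⟩
      simp [colorClass_adj] at huv
    obtain ⟨c₀, h₀, hmin⟩ := exists_minimalFor_of_wellFoundedLT
      (fun c : Sym2 V → Option (Fin k) => ∀ i, (colorClass G c i).IsAcyclic)
      (fun c => (uncolored G c).ncard) hne
    refine ⟨c₀, h₀, fun c hc => ?_⟩
    rcases le_total (uncolored G c₀).ncard (uncolored G c).ncard with h | h
    · exact h
    · exact hmin hc h
  set X := exchangeable G c₀ with hX
  set H := fromEdgeSet X with hH
  let e := Finite.equivFin H.ConnectedComponent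
  set s := Nat.card H.ConnectedComponent with hs
  have hcross := h s (fun v => e (H.connectedComponentMk v))
    (e.surjective.comp Quot.mk_surjective)
  set R := (crossing G fun v => e (H.connectedComponentMk v)).edgeSet with hR
  have hcomp (i : Fin k) : Nat.card (colorClass G c₀ i ⊓ H).ConnectedComponent = s := by
    refine Nat.card_congr (Quot.congrRight fun u v => ⟨fun huv => huv.mono inf_le_right, ?_⟩)
    intro huv
    rw [reachable_iff_reflTransGen] at huv
    refine Relation.ReflTransGen.rec Reachable.rfl (fun {u v} _ huv hru => hru.trans ?_) huv
    exact reachable_of_mem_exchangeable h₀ hopt ((fromEdgeSet_adj _).1 huv).1 i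
  have hinside (i : Fin k) : Nat.card V ≤ (colorClass G c₀ i ⊓ H).edgeSet.ncard + s := by
    rw [← hcomp i]
    exact card_le_ncard_edgeSet_add_card_connectedComponent _
  have hRsub : R ⊆ ⋃ i ∈ (Finset.univ : Finset (Fin k)),
      ((colorClass G c₀ i).edgeSet \ (colorClass G c₀ i ⊓ H).edgeSet) := by
    intro g hg
    induction g with | h u v => ?_
    have hnH : ¬ H.Adj u v := fun hadj =>
      hg.2 (congrArg e (ConnectedComponent.sound hadj.reachable))
    have hcol : c₀ s(u, v) ≠ none := fun hnone => hnH <| by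
      rw [hH, fromEdgeSet_adj]
      exact ⟨⟨c₀, Relation.ReflTransGen.refl, hg.1, hnone⟩, hg.1.ne⟩
    obtain ⟨i, hi⟩ := Option.ne_none_iff_exists'.1 hcol
    simp only [Finset.mem_univ, Set.iUnion_true, Set.mem_iUnion]
    refine ⟨i, colorClass_adj.2 ⟨hg.1, hi⟩, fun hmem => hnH ?_⟩
    exact (inf_le_right : colorClass G c₀ i ⊓ H ≤ H) hmem
  have hRcard : R.ncard ≤ ∑ i : Fin k,
      ((colorClass G c₀ i).edgeSet \ (colorClass G c₀ i ⊓ H).edgeSet).ncard :=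
    (Set.ncard_le_ncard hRsub (Set.toFinite _)).trans
      (Finset.set_ncard_biUnion_le _ _)
  have hsplit (i : Fin k) : ((colorClass G c₀ i).edgeSet \
      (colorClass G c₀ i ⊓ H).edgeSet).ncard + (colorClass G c₀ i ⊓ H).edgeSet.ncard =
      (colorClass G c₀ i).edgeSet.ncard :=
    Set.ncard_sdiff_add_ncard_of_subset (edgeSet_mono inf_le_left) (Set.toFinite _)
  have hle (i : Fin k) := ncard_edgeSet_add_one_le_of_isAcyclic (h₀ i)
  refine ⟨colorClass G c₀, fun i => ⟨inf_le_left, isTree_of_isAcyclic_of_card_le (h₀ i) ?_⟩,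
    fun i j hij => ?_⟩
  · by_contra hlt
    have hsum1 : ∑ i : Fin k, ((colorClass G c₀ i).edgeSet.ncard + 1) < ∑ _i : Fin k, Nat.card V :=
      Finset.sum_lt_sum (fun i _ => hle i) ⟨i, Finset.mem_univ i, not_le.1 hlt⟩
    have hsum2 := Finset.sum_le_sum fun (i : Fin k) (_ : i ∈ Finset.univ) => hinside i
    simp only [← hsplit, Finset.sum_add_distrib, Finset.sum_const, Finset.card_univ,
      Fintype.card_fin, smul_eq_mul, mul_one] at hsum1 hsum2
    omega
  · rw [Set.disjoint_left]
    intro g hgi hgj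
    rw [mem_edgeSet_colorClass] at hgi hgj
    exact hij (Option.some_injective _ (hgi.2.symm.trans hgj.2))

end TreePacking

namespace TreePacking

open SimpleGraph Finset

/-! ### The cut function of a graph -/

/-- The number of edges leaving a set of vertices. -/
def cut {V : Type*} [Fintype V] [DecidableEq V] (G : SimpleGraph V) [DecidableRel G.Adj]
    (X : Finset V) : ℕ :=
  edgesBetween G X (univ \ X)

section Cut

variable {V : Type*} [Fintype V] [DecidableEq V] (G : SimpleGraph V) [DecidableRel G.Adj]

theorem cut_eq_card (X : Finset V) :
    cut G X = #{p : V × V | G.Adj p.1 p.2 ∧ p.1 ∈ X ∧ p.2 ∉ X} := by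
  rw [cut, edgesBetween]
  congr 1
  ext ⟨u, v⟩
  simp [SimpleGraph.mk_mem_interedges_iff, and_comm, and_assoc]

theorem cut_eq_sum (X : Finset V) :
    cut G X = ∑ p : V × V, if G.Adj p.1 p.2 ∧ p.1 ∈ X ∧ p.2 ∉ X then 1 else 0 := by
  rw [cut_eq_card, card_filter]

theorem cut_compl (X : Finset V) : cut G Xᶜ = cut G X := by
  rw [cut_eq_sum, cut_eq_sum, ← Equiv.sum_comp (Equiv.prodComm V V)]
  refine sum_congr rfl fun p _ => if_congr ?_ rfl rfl
  simp [G.adj_comm p.2 p.1, and_comm]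

theorem cut_union_add_cut_inter_le (A B : Finset V) :
    cut G (A ∪ B) + cut G (A ∩ B) ≤ cut G A + cut G B := by
  simp only [cut_eq_sum, ← sum_add_distrib]
  refine sum_le_sum fun p _ => ?_
  by_cases h0 : G.Adj p.1 p.2 <;> by_cases h1 : p.1 ∈ A <;> by_cases h2 : p.1 ∈ B <;>
    by_cases h3 : p.2 ∈ A <;> by_cases h4 : p.2 ∈ B <;> simp [h0, h1, h2, h3, h4]

theorem cut_sdiff_add_cut_sdiff_le (A B : Finset V) :
    cut G (A \ B) + cut G (B \ A) ≤ cut G A + cut G B := by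
  have h := cut_union_add_cut_inter_le G A Bᶜ
  have h1 : A ∩ Bᶜ = A \ B := (sdiff_eq_inter_compl A B).symm
  have h2 : A ∪ Bᶜ = (B \ A)ᶜ := by
    ext x
    simp only [mem_union, mem_compl, mem_sdiff]
    tauto
  rw [h1, h2, cut_compl, cut_compl] at h
  omega

theorem cut_biUnion_le {ι : Type*} (s : Finset ι) (U : ι → Finset V) :
    cut G (s.biUnion U) ≤ ∑ i ∈ s, cut G (U i) := by
  classical
  simp only [cut_eq_card]
  refine (card_le_card ?_).trans card_biUnion_le
  intro p hp
  simp only [mem_filter, mem_univ, true_and, mem_biUnion, not_exists, not_and] at hp ⊢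
  obtain ⟨h, ⟨i, hi, hpi⟩, h'⟩ := hp
  exact ⟨i, hi, h, hpi, h' i hi⟩

theorem edgeConnectivity_le_cut {X : Finset V} (hX : X.Nonempty) (hX' : X ≠ univ) :
    edgeConnectivity G ≤ cut G X := by
  set S : Finset (Sym2 V) := ({p : V × V | G.Adj p.1 p.2 ∧ p.1 ∈ X ∧ p.2 ∉ X} : Finset _).image
    fun p => s(p.1, p.2) with hS
  have hle : S.card ≤ cut G X := by
    rw [cut_eq_card]
    exact card_image_le
  refine le_trans (Nat.sInf_le ⟨S, ?_, rfl, ?_⟩) hle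
  · intro e he
    simp only [hS, coe_image, Set.mem_image, mem_coe, mem_filter, mem_univ, true_and] at he
    obtain ⟨p, hp, rfl⟩ := he
    exact hp.1
  · intro hconn
    obtain ⟨x, hx⟩ := hX
    obtain ⟨y, hy⟩ : ∃ y, y ∉ X := by
      by_contra! h
      exact hX' (eq_univ_iff_forall.2 h)
    have hreach := hconn.preconnected x y
    rw [reachable_iff_reflTransGen] at hreach
    refine hy (Relation.ReflTransGen.rec hx (fun {u v} _ huv hu => ?_) hreach)
    by_contra hv
    rw [deleteEdges_adj] at huv
    refine huv.2 ?_
    simp only [hS, coe_image, Set.mem_image, mem_coe, mem_filter, mem_univ, true_and]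
    exact ⟨(u, v), ⟨huv.1, hu, hv⟩, rfl⟩

/-- Each vertex of `X` has at most `|X| - 1` neighbours in `X`, so that small sets have large
cuts. -/
theorem card_mul_succ_minDegree_le (X : Finset V) :
    #X * (G.minDegree + 1) ≤ cut G X + #X * #X := by
  have hcut : cut G X = ∑ u ∈ X, #{v | G.Adj u v ∧ v ∉ X} := by
    rw [cut_eq_sum, Fintype.sum_prod_type, ← sum_filter_add_sum_filter_not univ (· ∈ X)]
    rw [sum_eq_zero (s := {u | u ∉ X}), add_zero, filter_mem_eq_inter, univ_inter]
    · refine sum_congr rfl fun u hu => ?_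
      rw [card_filter]
      simp [hu]
    · intro u hu
      rw [mem_filter] at hu
      simp [hu.2]
  rw [hcut, ← smul_eq_mul #X #X, ← sum_const, ← sum_add_distrib, ← smul_eq_mul, ← sum_const]
  refine sum_le_sum fun u hu => ?_
  have h1 : #{v | G.Adj u v} = G.degree u := by
    rw [← card_neighborFinset_eq_degree, neighborFinset_eq_filter]
  have h2 : ({v | G.Adj u v} : Finset V) ⊆ ({v | G.Adj u v ∧ v ∉ X} : Finset V) ∪ X.erase u := by
    intro v hv
    rw [mem_filter] at hv
    by_cases hvX : v ∈ X
    · exact mem_union_right _ (mem_erase.2 ⟨hv.2.ne', hvX⟩)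
    · exact mem_union_left _ (mem_filter.2 ⟨mem_univ v, hv.2, hvX⟩)
  have h3 := (card_le_card h2).trans (card_union_le _ _)
  have h4 := card_erase_add_one hu
  have h5 := G.minDegree_le_degree u
  omega

theorem two_mul_ncard_crossing {ι : Type*} [Fintype ι] [DecidableEq ι] (f : V → ι) :
    2 * (crossing G f).edgeSet.ncard = ∑ j, cut G {v | f v = j} := by
  classical
  rw [Set.ncard_eq_toFinset_card', ← edgeFinset, ← sum_degrees_eq_twice_card_edges]
  simp only [cut_eq_sum, Fintype.sum_prod_type]
  rw [sum_comm]
  refine sum_congr rfl fun u _ => ?_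
  rw [sum_comm, ← card_neighborFinset_eq_degree, neighborFinset_eq_filter, card_filter]
  refine sum_congr rfl fun v _ => ?_
  rw [sum_eq_single (f u)]
  · refine if_congr ?_ rfl rfl
    simp [crossing, eq_comm]
  · intro j _ hj
    simp [hj.symm]
  · simp

/-- Uncrossing: if `U` is a minimum cut which meets the part with label `i`, then moving all of `U`
to that part does not increase the sum of the cuts of the parts. -/
theorem sum_cut_ite_le {ι : Type*} [Fintype ι] [DecidableEq ι] (f : V → ι) {U : Finset V}
    (hU : cut G U = edgeConnectivity G) (hU' : U ≠ univ) {x : V} (hx : x ∈ U) :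
    ∑ j, cut G {v | (if v ∈ U then f x else f v) = j} ≤ ∑ j, cut G {v | f v = j} := by
  refine sum_le_sum fun j _ => ?_
  have hproper {Y : Finset V} (hY : Y ⊆ U) : Y ≠ univ := fun h =>
    hU' (univ_subset_iff.1 (h ▸ hY))
  by_cases hj : f x = j
  · have h1 : ({v | (if v ∈ U then f x else f v) = j} : Finset V) =
        ({v | f v = j} : Finset V) ∪ U := by
      ext v
      by_cases hv : v ∈ U <;> simp [hv, hj]
    have h2 := cut_union_add_cut_inter_le G {v | f v = j} U
    have h3 : edgeConnectivity G ≤ cut G (({v | f v = j} : Finset V) ∩ U) :=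
      edgeConnectivity_le_cut G ⟨x, by simp [hj, hx]⟩ (hproper inter_subset_right)
    rw [h1]
    omega
  · have h1 : ({v | (if v ∈ U then f x else f v) = j} : Finset V) =
        ({v | f v = j} : Finset V) \ U := by
      ext v
      by_cases hv : v ∈ U <;> simp [hv, hj]
    have h2 := cut_sdiff_add_cut_sdiff_le G {v | f v = j} U
    have h3 : edgeConnectivity G ≤ cut G (U \ ({v | f v = j} : Finset V)) :=
      edgeConnectivity_le_cut G ⟨x, by simp [hj, hx]⟩ (hproper sdiff_subset)
    rw [h1]
    omega

end Cut

end TreePacking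

namespace TreePacking

open Matrix Finset

/-! ### Rayleigh quotients and eigenvalues -/

/-- Fewer than `m` linear conditions on the combinations of `m` vectors have a common zero with
coefficients that do not all vanish. -/
theorem exists_ne_zero_forall_dotProduct_eq_zero {V ι : Type*} [Fintype V] (J : Finset ι)
    (w : ι → V → ℝ) {m : ℕ} (hJ : #J < m) (x : Fin m → V → ℝ) :
    ∃ c : Fin m → ℝ, c ≠ 0 ∧ ∀ j ∈ J, (∑ i, c i • x i) ⬝ᵥ w j = 0 := by
  let L : (Fin m → ℝ) →ₗ[ℝ] (J → ℝ) :=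
    LinearMap.pi fun j =>
      ∑ i, (LinearMap.proj (R := ℝ) (φ := fun _ : Fin m => ℝ) i).smulRight (x i ⬝ᵥ w j)
  have hL : ¬ Function.Injective L := fun hinj => by
    have := LinearMap.finrank_le_finrank_of_injective hinj
    simp at this
    omega
  obtain ⟨c, hc, hc'⟩ : ∃ c, L c = 0 ∧ c ≠ 0 := by
    by_contra! h
    exact hL ((injective_iff_map_eq_zero L).2 h)
  refine ⟨c, hc', fun j hj => ?_⟩
  have h := congrFun hc ⟨j, hj⟩
  simpa [L, sum_dotProduct] using h

theorem dotProduct_eq_sum_dotProduct_mul {V ι : Type*} [Fintype V] [Fintype ι]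
    (b : OrthonormalBasis ι ℝ (EuclideanSpace ℝ V)) (y z : V → ℝ) :
    y ⬝ᵥ z = ∑ j, (y ⬝ᵥ (b j).ofLp) * (z ⬝ᵥ (b j).ofLp) := by
  have h := b.sum_inner_mul_inner (WithLp.toLp 2 y) (WithLp.toLp 2 z)
  simp only [EuclideanSpace.inner_eq_star_dotProduct, star_trivial] at h
  rw [dotProduct_comm, ← h]
  exact sum_congr rfl fun j _ => by rw [dotProduct_comm y]

theorem dotProduct_mulVec_eq_sum_eigenvalues {V : Type*} [Fintype V] [DecidableEq V]
    {M : Matrix V V ℝ} (hM : M.IsHermitian) (y : V → ℝ) :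
    y ⬝ᵥ M *ᵥ y = ∑ j, hM.eigenvalues j * (y ⬝ᵥ (hM.eigenvectorBasis j).ofLp) ^ 2 := by
  rw [dotProduct_eq_sum_dotProduct_mul hM.eigenvectorBasis]
  refine sum_congr rfl fun j _ => ?_
  have hsymm : Mᵀ = M := by
    rw [← conjTranspose_eq_transpose_of_trivial]
    exact hM
  have h : (M *ᵥ y) ⬝ᵥ (hM.eigenvectorBasis j).ofLp =
      hM.eigenvalues j * (y ⬝ᵥ (hM.eigenvectorBasis j).ofLp) := by
    rw [dotProduct_comm, dotProduct_mulVec, ← mulVec_transpose, hsymm,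
      hM.mulVec_eigenvectorBasis, smul_dotProduct, smul_eq_mul, dotProduct_comm y]
  rw [h]
  ring

/-- Half of the minimax principle: an `i`-dimensional space on which the Rayleigh quotient of `M` is
at least `t` shows that the `i`-th largest eigenvalue is at least `t`. -/
theorem le_nthLargestEigenvalue {V : Type*} [Fintype V] [DecidableEq V] {M : Matrix V V ℝ}
    (hM : M.IsHermitian) {i : ℕ} (hi : 1 ≤ i) (hi' : i ≤ Fintype.card V) (x : Fin i → V → ℝ)
    (hx : LinearIndependent ℝ x) {t : ℝ}
    (ht : ∀ c : Fin i → ℝ, t * ((∑ l, c l • x l) ⬝ᵥ ∑ l, c l • x l) ≤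
      (∑ l, c l • x l) ⬝ᵥ M *ᵥ ∑ l, c l • x l) :
    t ≤ nthLargestEigenvalue M i := by
  rw [nthLargestEigenvalue, dif_pos ⟨hM, hi, hi'⟩]
  let idx : V ≃ Fin (Fintype.card V) := (Fintype.equivOfCardEq (Fintype.card_fin _)).symm
  let J : Finset V := {j | idx j < i - 1}
  have hJ : #J < i := by
    have h : #J ≤ #(range (i - 1)) :=
      card_le_card_of_injOn (fun j => (idx j : ℕ)) (fun j hj => by simpa [J] using hj)
        (fun a _ b _ hab => idx.injective (Fin.ext hab))
    rw [card_range] at h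
    omega
  obtain ⟨c, hc, horth⟩ := exists_ne_zero_forall_dotProduct_eq_zero J
    (fun j => (hM.eigenvectorBasis j).ofLp) hJ x
  specialize ht c
  set y := ∑ l, c l • x l with hy
  have hpos : 0 < y ⬝ᵥ y := by
    refine lt_of_le_of_ne (sum_nonneg fun v _ => mul_self_nonneg (y v)) fun h => hc (funext fun l => ?_)
    exact Fintype.linearIndependent_iff.1 hx c (dotProduct_self_eq_zero.1 h.symm) l
  have hle : y ⬝ᵥ M *ᵥ y ≤ hM.eigenvalues₀ ⟨i - 1, by omega⟩ * (y ⬝ᵥ y) := by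
    rw [dotProduct_mulVec_eq_sum_eigenvalues hM,
      dotProduct_eq_sum_dotProduct_mul hM.eigenvectorBasis y y, mul_sum]
    refine sum_le_sum fun j _ => ?_
    by_cases hj : j ∈ J
    · simp [horth j hj]
    · rw [← sq]
      refine mul_le_mul_of_nonneg_right (hM.eigenvalues₀_antitone ?_) (sq_nonneg _)
      simpa [J, Fin.le_def] using hj
  exact le_of_mul_le_mul_right (ht.trans hle) hpos

/-- The other half of the minimax principle: an `m`-dimensional space on which the Rayleigh quotient
of `M` is at most `t` shows that the `m`-th smallest eigenvalue is at most `t`. -/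
theorem nthLargestEigenvalue_le {V : Type*} [Fintype V] [DecidableEq V] {M : Matrix V V ℝ}
    (hM : M.IsHermitian) {i m : ℕ} (hi : 1 ≤ i) (hm : 1 ≤ m) (him : i + m = Fintype.card V + 1)
    (x : Fin m → V → ℝ) (hx : LinearIndependent ℝ x) {t : ℝ}
    (ht : ∀ c : Fin m → ℝ, (∑ l, c l • x l) ⬝ᵥ M *ᵥ ∑ l, c l • x l ≤
      t * ((∑ l, c l • x l) ⬝ᵥ ∑ l, c l • x l)) :
    nthLargestEigenvalue M i ≤ t := by
  rw [nthLargestEigenvalue, dif_pos ⟨hM, hi, by omega⟩]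
  let idx : V ≃ Fin (Fintype.card V) := (Fintype.equivOfCardEq (Fintype.card_fin _)).symm
  let J : Finset V := {j | i - 1 < idx j}
  have hJ : #J < m := by
    have h : #J ≤ #(Ico i (Fintype.card V)) :=
      card_le_card_of_injOn (fun j => (idx j : ℕ)) (fun j hj => by
        simp only [J, coe_filter, mem_univ, true_and, Set.mem_ofPred_eq] at hj
        simp only [coe_Ico, Set.mem_Ico]
        exact ⟨by omega, (idx j).2⟩)
        (fun a _ b _ hab => idx.injective (Fin.ext hab))
    rw [Nat.card_Ico] at h
    omega
  obtain ⟨c, hc, horth⟩ := exists_ne_zero_forall_dotProduct_eq_zero J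
    (fun j => (hM.eigenvectorBasis j).ofLp) hJ x
  specialize ht c
  set y := ∑ l, c l • x l with hy
  have hpos : 0 < y ⬝ᵥ y := by
    refine lt_of_le_of_ne (sum_nonneg fun v _ => mul_self_nonneg (y v)) fun h => hc (funext fun l => ?_)
    exact Fintype.linearIndependent_iff.1 hx c (dotProduct_self_eq_zero.1 h.symm) l
  have hle : hM.eigenvalues₀ ⟨i - 1, by omega⟩ * (y ⬝ᵥ y) ≤ y ⬝ᵥ M *ᵥ y := by
    rw [dotProduct_mulVec_eq_sum_eigenvalues hM,
      dotProduct_eq_sum_dotProduct_mul hM.eigenvectorBasis y y, mul_sum]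
    refine sum_le_sum fun j _ => ?_
    by_cases hj : j ∈ J
    · simp [horth j hj]
    · rw [← sq]
      refine mul_le_mul_of_nonneg_right (hM.eigenvalues₀_antitone ?_) (sq_nonneg _)
      simpa [J, Fin.le_def] using hj
  exact le_of_mul_le_mul_right (hle.trans ht) hpos

/-! ### Rayleigh quotients on spaces of step functions -/

section Step

variable {V : Type*} [DecidableEq V] {ι : Type*} [Fintype ι] {U : ι → Finset V}

/-- The indicator function of a set of vertices. -/
def indicatorVec (X : Finset V) : V → ℝ := fun v => if v ∈ X then 1 else 0

theorem sum_smul_indicatorVec_apply [DecidableEq ι] (hU : ∀ i j, i ≠ j → Disjoint (U i) (U j))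
    (c : ι → ℝ) {i : ι} {v : V} (hv : v ∈ U i) : (∑ l, c l • indicatorVec (U l)) v = c i := by
  rw [Finset.sum_apply, sum_eq_single i]
  · simp [indicatorVec, hv]
  · intro j _ hj
    simp [indicatorVec, disjoint_left.1 (hU i j hj.symm) hv]
  · simp

theorem sum_smul_indicatorVec_apply_of_notMem (c : ι → ℝ) {v : V} (hv : ∀ i, v ∉ U i) :
    (∑ l, c l • indicatorVec (U l)) v = 0 := by
  rw [Finset.sum_apply]
  exact sum_eq_zero fun j _ => by simp [indicatorVec, hv j]

theorem linearIndependent_indicatorVec (hU : ∀ i j, i ≠ j → Disjoint (U i) (U j))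
    (hne : ∀ i, (U i).Nonempty) : LinearIndependent ℝ fun i => indicatorVec (U i) := by
  classical
  rw [Fintype.linearIndependent_iff]
  intro c hc i
  obtain ⟨v, hv⟩ := hne i
  rw [← sum_smul_indicatorVec_apply hU c hv, hc, Pi.zero_apply]

end Step

section Step

variable {V : Type*} [Fintype V] [DecidableEq V] (G : SimpleGraph V) [DecidableRel G.Adj]
  {ι : Type*} [Fintype ι] {U : ι → Finset V}

theorem dotProduct_mulVec_degMatrix_add_adjMatrix (a b : ℝ) (y : V → ℝ) :
    y ⬝ᵥ (a • G.degMatrix ℝ + b • G.adjMatrix ℝ) *ᵥ y =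
      (a + b) * ∑ v, G.degree v * y v ^ 2 -
        b * ((∑ u, ∑ v, if G.Adj u v then (y u - y v) ^ 2 else 0) / 2) := by
  have h := G.lapMatrix_toLinearMap₂' ℝ y
  rw [toLinearMap₂'_apply', SimpleGraph.lapMatrix, sub_mulVec, dotProduct_sub,
    G.dotProduct_mulVec_degMatrix] at h
  rw [← h, add_mulVec, dotProduct_add, smul_mulVec, smul_mulVec, dotProduct_smul, dotProduct_smul,
    G.dotProduct_mulVec_degMatrix, smul_eq_mul, smul_eq_mul]
  have h' : ∑ v, (G.degree v : ℝ) * y v ^ 2 = ∑ v, (G.degree v : ℝ) * y v * y v :=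
    sum_congr rfl fun v _ => by ring
  rw [h']
  ring

theorem sum_smul_indicatorVec_dotProduct_self (hU : ∀ i j, i ≠ j → Disjoint (U i) (U j))
    (c : ι → ℝ) : (∑ l, c l • indicatorVec (U l)) ⬝ᵥ (∑ l, c l • indicatorVec (U l)) =
      ∑ i, #(U i) * c i ^ 2 := by
  classical
  have h (v : V) : (∑ l, c l • indicatorVec (U l)) v * (∑ l, c l • indicatorVec (U l)) v =
      ∑ i, if v ∈ U i then c i ^ 2 else 0 := by
    by_cases hv : ∃ i, v ∈ U i
    · obtain ⟨i, hi⟩ := hv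
      rw [sum_smul_indicatorVec_apply hU c hi, sum_eq_single i]
      · rw [if_pos hi, sq]
      · intro j _ hj
        rw [if_neg (disjoint_left.1 (hU i j hj.symm) hi)]
      · simp
    · push Not at hv
      simp [sum_smul_indicatorVec_apply_of_notMem c hv, hv]
  rw [dotProduct, sum_congr rfl fun v _ => h v, sum_comm]
  refine sum_congr rfl fun i _ => ?_
  rw [← sum_filter, sum_const, nsmul_eq_mul, filter_mem_eq_inter, univ_inter]

/-- Weights `p`, `q` with `1 / p + 1 / q ≤ 1` bound the square of a difference. -/
theorem sub_sq_le_of_add_le_mul {p q : ℝ} (hp : 0 < p) (hq : 0 < q) (h : p + q ≤ p * q)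
    (x y : ℝ) : (x - y) ^ 2 ≤ p * x ^ 2 + q * y ^ 2 := by
  have hp1 : 0 < p - 1 := by
    by_contra! h1
    nlinarith
  have h1 : 0 ≤ (p - 1) * (p * x ^ 2 + q * y ^ 2 - (x - y) ^ 2) := by
    have h2 : (p - 1) * (p * x ^ 2 + q * y ^ 2 - (x - y) ^ 2) =
        ((p - 1) * x + y) ^ 2 + (p * q - (p + q)) * y ^ 2 := by ring
    rw [h2]
    have := mul_nonneg (sub_nonneg.2 h) (sq_nonneg y)
    positivity
  exact sub_nonneg.1 (nonneg_of_mul_nonneg_right h1 hp1)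

/-- The Laplacian form of a step function is bounded by the cuts of its steps. -/
theorem laplacian_sum_smul_indicatorVec_le [Nontrivial ι]
    (hU : ∀ i j, i ≠ j → Disjoint (U i) (U j))
    {p : ι → ℝ} (hp : ∀ i, 0 < p i) (hp' : ∀ i j, i ≠ j → p i + p j ≤ p i * p j) (c : ι → ℝ) :
    (∑ u, ∑ v, if G.Adj u v then ((∑ l, c l • indicatorVec (U l)) u -
      (∑ l, c l • indicatorVec (U l)) v) ^ 2 else 0) / 2 ≤ ∑ i, p i * cut G (U i) * c i ^ 2 := by
  classical
  set y := ∑ l, c l • indicatorVec (U l) with hy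
  -- `g u v` collects the contributions of the steps which the arc from `u` to `v` leaves
  let g (u v : V) : ℝ := ∑ i, if G.Adj u v ∧ u ∈ U i ∧ v ∉ U i then p i * c i ^ 2 else 0
  have hp1 (i : ι) : 1 ≤ p i := by
    obtain ⟨j, hj⟩ := exists_ne i
    nlinarith [hp i, hp j, hp' i j hj.symm]
  have hg0 (u v : V) : 0 ≤ g u v := sum_nonneg fun i _ => by
    have := hp i
    split_ifs <;> positivity
  have hg {u v : V} {i : ι} (hadj : G.Adj u v) (hu : u ∈ U i) (hv : v ∉ U i) :
      p i * y u ^ 2 ≤ g u v := by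
    rw [hy, sum_smul_indicatorVec_apply hU c hu]
    refine le_trans (le_of_eq ?_) (single_le_sum (f := fun i =>
      if G.Adj u v ∧ u ∈ U i ∧ v ∉ U i then p i * c i ^ 2 else 0) (fun j _ => ?_) (mem_univ i))
    · simp [hadj, hu, hv]
    · have := hp j
      split_ifs <;> positivity
  have hy0 {v : V} (hv : ∀ i, v ∉ U i) : y v = 0 :=
    sum_smul_indicatorVec_apply_of_notMem c hv
  have hpt (u v : V) : (if G.Adj u v then (y u - y v) ^ 2 else 0) ≤ g u v + g v u := by
    by_cases hadj : G.Adj u v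
    · rw [if_pos hadj]
      by_cases hu : ∃ i, u ∈ U i
      · obtain ⟨i, hi⟩ := hu
        by_cases hv : ∃ j, v ∈ U j
        · obtain ⟨j, hj⟩ := hv
          by_cases hij : i = j
          · subst hij
            have h1 : y u = y v := by
              rw [hy, sum_smul_indicatorVec_apply hU c hi, sum_smul_indicatorVec_apply hU c hj]
            rw [h1, sub_self, zero_pow two_ne_zero]
            exact add_nonneg (hg0 u v) (hg0 v u)
          · exact (sub_sq_le_of_add_le_mul (hp i) (hp j) (hp' i j hij) _ _).trans
              (add_le_add (hg hadj hi (disjoint_right.1 (hU i j hij) hj))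
                (hg hadj.symm hj (disjoint_left.1 (hU i j hij) hi)))
        · push Not at hv
          have h1 := hg hadj hi (hv i)
          have h2 : 1 * y u ^ 2 ≤ p i * y u ^ 2 :=
            mul_le_mul_of_nonneg_right (hp1 i) (sq_nonneg _)
          rw [hy0 hv, sub_zero]
          linarith [hg0 v u]
      · push Not at hu
        rw [hy0 hu, zero_sub, neg_sq]
        by_cases hv : ∃ j, v ∈ U j
        · obtain ⟨j, hj⟩ := hv
          have h1 := hg hadj.symm hj (hu j)
          have h2 : 1 * y v ^ 2 ≤ p j * y v ^ 2 :=
            mul_le_mul_of_nonneg_right (hp1 j) (sq_nonneg _)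
          linarith [hg0 u v]
        · push Not at hv
          rw [hy0 hv, zero_pow two_ne_zero]
          exact add_nonneg (hg0 u v) (hg0 v u)
    · rw [if_neg hadj]
      exact add_nonneg (hg0 u v) (hg0 v u)
  have hsum : ∑ u, ∑ v, g u v = ∑ i, p i * cut G (U i) * c i ^ 2 := by
    rw [← Fintype.sum_prod_type', sum_comm]
    refine sum_congr rfl fun i _ => ?_
    rw [← sum_filter, sum_const, nsmul_eq_mul, ← cut_eq_card]
    ring
  have hle : ∑ u, ∑ v, (if G.Adj u v then (y u - y v) ^ 2 else 0) ≤
      ∑ u, ∑ v, (g u v + g v u) :=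
    sum_le_sum fun u _ => sum_le_sum fun v _ => hpt u v
  simp only [sum_add_distrib] at hle
  rw [sum_comm (f := fun u v => g v u), hsum] at hle
  linarith

end Step

end TreePacking

namespace TreePacking

open Finset

theorem minDegree_mul_dotProduct_self_le {V : Type*} [Fintype V]
    (G : SimpleGraph V) [DecidableRel G.Adj] (y : V → ℝ) :
    G.minDegree * (y ⬝ᵥ y) ≤ ∑ v, G.degree v * y v ^ 2 := by
  rw [dotProduct, mul_sum]
  refine sum_le_sum fun v _ => ?_
  rw [← sq]
  exact mul_le_mul_of_nonneg_right (by exact_mod_cast G.minDegree_le_degree v) (sq_nonneg _)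

/-! ### Partitions of the vertex set -/

section Partition

variable {V : Type*} [Fintype V] [DecidableEq V] (G : SimpleGraph V) [DecidableRel G.Adj]

/-- The combinatorial content of the eigenvalue bounds: four disjoint sets of at least `δ` vertices
cannot all have small cuts, where the cuts are weighted as in
`laplacian_sum_smul_indicatorVec_le`. The threshold `4 (2 k + 1)` is what three cuts of size at most
`2 k + 1` and the set of the remaining vertices reach with the weights of a star. -/
def NoFourSmallCuts (k δ : ℕ) : Prop :=
  ∀ (U : Fin 4 → Finset V) (p : Fin 4 → ℝ), (∀ i j, i ≠ j → Disjoint (U i) (U j)) →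
    (∀ i, δ ≤ #(U i)) → (∀ i, 0 < p i) → (∀ i j, i ≠ j → p i + p j ≤ p i * p j) →
    ∃ i, 8 * (k : ℝ) + 4 < p i * cut G (U i)

variable {G} {k δ : ℕ}

theorem NoFourSmallCuts.exists_lt_cut (h : NoFourSmallCuts G k δ) (U : Fin 4 → Finset V)
    (hU : ∀ i j, i ≠ j → Disjoint (U i) (U j)) (hcard : ∀ i, δ ≤ #(U i)) :
    ∃ i, 4 * k + 2 < cut G (U i) := by
  obtain ⟨i, hi⟩ := h U (fun _ => 2) hU hcard (fun _ => by norm_num) (fun _ _ _ => by norm_num)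
  refine ⟨i, ?_⟩
  have : (4 * k + 2 : ℝ) < cut G (U i) := by linarith
  exact_mod_cast this

/-- Three disjoint sets with cuts of at most `2 k + 1` edges and the set of the remaining
vertices. The remainder may have a cut three times as large, so the weights are those of a star. -/
theorem NoFourSmallCuts.card_compl_lt (h : NoFourSmallCuts G k δ) (U : Fin 3 → Finset V)
    (hU : ∀ i j, i ≠ j → Disjoint (U i) (U j)) (hcard : ∀ i, δ ≤ #(U i))
    (hcut : ∀ i, cut G (U i) ≤ 2 * k + 1) : #(univ.biUnion U)ᶜ < δ := by
  by_contra! hW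
  have hcutW : cut G (univ.biUnion U)ᶜ ≤ 3 * (2 * k + 1) := by
    rw [cut_compl]
    refine (cut_biUnion_le G _ _).trans ((sum_le_card_nsmul _ _ _ fun i _ => hcut i).trans ?_)
    simp
  have hd (i : Fin 3) : Disjoint (U i) (univ.biUnion U)ᶜ :=
    disjoint_compl_right.mono_left (subset_biUnion_of_mem U (mem_univ i))
  let U' : Fin 4 → Finset V := Fin.snoc (α := fun _ => Finset V) U (univ.biUnion U)ᶜ
  let p : Fin 4 → ℝ := Fin.snoc (α := fun _ => ℝ) (fun _ : Fin 3 => (4 : ℝ)) (4 / 3)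
  have hUc (i : Fin 3) : U' i.castSucc = U i := Fin.snoc_castSucc ..
  have hUl : U' (Fin.last 3) = (univ.biUnion U)ᶜ := Fin.snoc_last ..
  have hpc (i : Fin 3) : p i.castSucc = 4 := Fin.snoc_castSucc ..
  have hpl : p (Fin.last 3) = 4 / 3 := Fin.snoc_last ..
  have hdisj : ∀ i j, i ≠ j → Disjoint (U' i) (U' j) := by
    intro i j hij
    cases i using Fin.lastCases with
    | last =>
      cases j using Fin.lastCases with
      | last => exact absurd rfl hij
      | cast j => simpa only [hUc, hUl] using (hd j).symm
    | cast i =>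
      cases j using Fin.lastCases with
      | last => simpa only [hUc, hUl] using hd i
      | cast j => simpa only [hUc] using hU i j (fun h => hij (by rw [h]))
  have hcard' : ∀ i, δ ≤ #(U' i) := by
    intro i
    cases i using Fin.lastCases with
    | last => rwa [hUl]
    | cast i => rw [hUc]; exact hcard i
  have hp : ∀ i, 0 < p i := by
    intro i
    cases i using Fin.lastCases with
    | last => rw [hpl]; norm_num
    | cast i => rw [hpc]; norm_num
  have hp' : ∀ i j, i ≠ j → p i + p j ≤ p i * p j := by
    intro i j hij
    cases i using Fin.lastCases with
    | last =>
      cases j using Fin.lastCases with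
      | last => exact absurd rfl hij
      | cast j => rw [hpl, hpc]; norm_num
    | cast i =>
      cases j using Fin.lastCases with
      | last => rw [hpl, hpc]; norm_num
      | cast j => rw [hpc, hpc]; norm_num
  obtain ⟨i, hi⟩ := h U' p hdisj hcard' hp hp'
  cases i using Fin.lastCases with
  | last =>
    rw [hUl, hpl] at hi
    have h1 : (cut G (univ.biUnion U)ᶜ : ℝ) ≤ 3 * (2 * k + 1) := by exact_mod_cast hcutW
    linarith
  | cast i =>
    rw [hUc, hpc] at hi
    have h1 : (cut G (U i) : ℝ) ≤ 2 * k + 1 := by exact_mod_cast hcut i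
    linarith

/-- By `card_mul_succ_minDegree_le`, a set of `m ≤ δ` vertices has at least `m (δ + 1 - m) ≥ δ` edges
in its cut. -/
theorem minDegree_lt_card_of_cut_lt {X : Finset V} (hX : X.Nonempty)
    (hcut : cut G X < G.minDegree) : G.minDegree < #X := by
  by_contra! hle
  have h1 := card_mul_succ_minDegree_le G X
  have h2 := hX.card_pos
  obtain ⟨r, hr⟩ := Nat.exists_eq_add_of_le hle
  obtain ⟨m, hm⟩ := Nat.exists_eq_add_of_le' h2
  rw [hr] at h1 hcut
  rw [hm] at h1 hcut
  nlinarith [Nat.zero_le (m * r)]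

/-- A set whose cut has less than `2 (δ - 1)` edges consists of one vertex or of at least `δ`
vertices. -/
theorem card_eq_one_of_cut_add_two_lt {X : Finset V} (hX : X.Nonempty)
    (hcut : cut G X + 2 < 2 * G.minDegree) (hcard : #X < G.minDegree) : #X = 1 := by
  by_contra! hne
  have h1 := card_mul_succ_minDegree_le G X
  have h2 : 2 ≤ #X := by
    have := hX.card_pos
    omega
  obtain ⟨r, hr⟩ := Nat.exists_eq_add_of_lt hcard
  obtain ⟨m, hm⟩ := Nat.exists_eq_add_of_le' h2
  rw [hr] at h1 hcut
  rw [hm] at h1 hcut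
  nlinarith [Nat.zero_le (m * r)]

/-- If three disjoint large sets with small cuts cover all vertices but `v`, then a partition into
three large parts with small cuts has three distinct parts meeting them: where Hall's condition
fails, two sets lie in one part, and together with the other two parts they are four large disjoint
sets with small cuts. -/
theorem NoFourSmallCuts.exists_injective (h : NoFourSmallCuts G k δ) (hδ : 0 < δ)
    {U : Fin 3 → Finset V} (hne : ∀ i, (U i).Nonempty)
    (hU : ∀ i j, i ≠ j → Disjoint (U i) (U j)) (hcardU : ∀ i, δ ≤ #(U i))
    (hcutU : ∀ i, cut G (U i) ≤ 4 * k + 2) {v : V} (hv : (univ.biUnion U)ᶜ = {v})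
    {f : V → Fin 3} (hcardf : ∀ j, δ < #{x | f x = j})
    (hcutf : ∀ j, cut G {x | f x = j} ≤ 4 * k + 2) :
    ∃ σ : Fin 3 → Fin 3, Function.Injective σ ∧ ∀ i, σ i ∈ (U i).image f := by
  rw [← all_card_le_biUnion_card_iff_exists_injective]
  intro S
  by_contra! hlt
  have hS3 : #S ≤ 3 := card_le_univ S
  have hpos : 0 < #(S.biUnion fun i => (U i).image f) := by
    obtain ⟨i, hi⟩ := card_pos.1 (Nat.zero_lt_of_lt hlt)
    exact card_pos.2 (((hne i).image f).mono (subset_biUnion_of_mem (fun i => (U i).image f) hi))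
  rcases (by omega : #S = 3 ∨ #S = 2) with hS | hS
  · -- some part misses all three sets, so `v` is its only vertex
    obtain ⟨j, hj⟩ : ∃ j, j ∉ S.biUnion fun i => (U i).image f := by
      by_contra! hall
      rw [eq_univ_iff_forall.2 hall, hS] at hlt
      simp at hlt
    have hSu : S = univ := (card_eq_iff_eq_univ S).1 hS
    have hsub : ({x | f x = j} : Finset V) ⊆ {v} := by
      intro x hx
      rw [← hv, mem_compl, mem_biUnion]
      rintro ⟨i, -, hxi⟩
      refine hj (mem_biUnion.2 ⟨i, by simp [hSu], mem_image.2 ⟨x, hxi, ?_⟩⟩)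
      simpa using hx
    have h1 := card_le_card hsub
    have h2 := hcardf j
    rw [card_singleton] at h1
    omega
  · -- two of the sets lie in the same part, and the other two parts are disjoint from them
    obtain ⟨j, hj⟩ := card_eq_one.1 (by omega : #(S.biUnion fun i => (U i).image f) = 1)
    obtain ⟨a, b, hab, rfl⟩ := card_eq_two.1 hS
    obtain ⟨c, d, hcd, hjc⟩ := card_eq_two.1 (by simp [card_compl] : #({j}ᶜ : Finset (Fin 3)) = 2)
    have hcj : c ≠ j := by
      have : c ∈ ({j}ᶜ : Finset (Fin 3)) := by simp [hjc]
      simpa using this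
    have hdj : d ≠ j := by
      have : d ∈ ({j}ᶜ : Finset (Fin 3)) := by simp [hjc]
      simpa using this
    have hin {i : Fin 3} (hi : i ∈ ({a, b} : Finset (Fin 3))) {x : V} (hx : x ∈ U i) : f x = j := by
      have : f x ∈ ({a, b} : Finset (Fin 3)).biUnion fun i => (U i).image f :=
        mem_biUnion.2 ⟨i, hi, mem_image_of_mem f hx⟩
      rwa [hj, mem_singleton] at this
    have hdisj {i l : Fin 3} (hi : i ∈ ({a, b} : Finset (Fin 3))) (hl : l ≠ j) :
        Disjoint (U i) ({x | f x = l} : Finset V) := by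
      rw [disjoint_left]
      intro x hx hx'
      rw [mem_filter] at hx'
      exact hl (hx'.2.symm.trans (hin hi hx))
    have hdisj' : Disjoint ({x | f x = c} : Finset V) ({x | f x = d} : Finset V) := by
      rw [disjoint_left]
      intro x hx hx'
      rw [mem_filter] at hx hx'
      exact hcd (hx.2.symm.trans hx'.2)
    let P (l : Fin 3) : Finset V := {x | f x = l}
    have ha : a ∈ ({a, b} : Finset (Fin 3)) := by simp
    have hb : b ∈ ({a, b} : Finset (Fin 3)) := by simp
    have hac : Disjoint (U a) (P c) := hdisj ha hcj
    have had : Disjoint (U a) (P d) := hdisj ha hdj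
    have hbc : Disjoint (U b) (P c) := hdisj hb hcj
    have hbd : Disjoint (U b) (P d) := hdisj hb hdj
    have hPcd : Disjoint (P c) (P d) := hdisj'
    obtain ⟨i, hi⟩ := h.exists_lt_cut ![U a, U b, P c, P d]
      (by
        simp only [Fin.forall_fin_succ]
        simp [hU a b hab, (hU a b hab).symm, hac, had, hbc, hbd, hac.symm, had.symm, hbc.symm,
          hbd.symm, hPcd, hPcd.symm])
      (by
        simp only [Fin.forall_fin_succ]
        simp [hcardU, P, (hcardf _).le])
    have hle : ∀ i, cut G (![U a, U b, P c, P d] i) ≤ 4 * k + 2 := by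
      simp only [Fin.forall_fin_succ]
      simp [hcutU, P, hcutf]
    exact absurd (hle i) (not_le.2 hi)

/-- Uncrossing: a partition into three parts, which meet three disjoint minimum cuts in a
matching, is at least as expensive as one whose parts are these cuts, up to one vertex `v`. -/
theorem minDegree_add_edgeConnectivity_le_sum_cut {U : Fin 3 → Finset V}
    (huniv : ∀ i, U i ≠ univ) (hU : ∀ i j, i ≠ j → Disjoint (U i) (U j))
    (hcutU : ∀ i, cut G (U i) = edgeConnectivity G) {v : V} (hv : (univ.biUnion U)ᶜ = {v})
    {f : V → Fin 3} {σ : Fin 3 → Fin 3} (hσ : Function.Injective σ)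
    (hσf : ∀ i, σ i ∈ (U i).image f) :
    G.minDegree + edgeConnectivity G ≤ ∑ j, cut G {x | f x = j} := by
  simp only [mem_image] at hσf
  choose x hxU hxf using hσf
  have hnot {i j : Fin 3} (hij : i ≠ j) {y : V} (hy : y ∈ U i) : y ∉ U j :=
    disjoint_left.1 (hU i j hij) hy
  have hvU (i : Fin 3) : v ∉ U i := by
    have hv' : v ∈ (univ.biUnion U)ᶜ := by simp [hv]
    intro hvi
    exact mem_compl.1 hv' (mem_biUnion.2 ⟨i, mem_univ i, hvi⟩)
  have hcov (y : V) : y = v ∨ ∃ i, y ∈ U i := by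
    by_cases hy : y ∈ (univ.biUnion U)ᶜ
    · left
      simpa [hv] using hy
    · right
      simpa using hy
  obtain ⟨g, hgU, hgv, hgle⟩ : ∃ g : V → Fin 3, (∀ i, ∀ y ∈ U i, g y = σ i) ∧ g v = f v ∧
      ∑ j, cut G {x | g x = j} ≤ ∑ j, cut G {x | f x = j} := by
    -- the three sets are moved, one after the other, to the parts which they meet
    let f₁ : V → Fin 3 := fun y => if y ∈ U 0 then f (x 0) else f y
    let f₂ : V → Fin 3 := fun y => if y ∈ U 1 then f₁ (x 1) else f₁ y
    let f₃ : V → Fin 3 := fun y => if y ∈ U 2 then f₂ (x 2) else f₂ y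
    have h10 : x 1 ∉ U 0 := hnot (by decide) (hxU 1)
    have h20 : x 2 ∉ U 0 := hnot (by decide) (hxU 2)
    have h21 : x 2 ∉ U 1 := hnot (by decide) (hxU 2)
    refine ⟨f₃, fun i y hy => ?_, ?_, ?_⟩
    · fin_cases i
      · have h1 : y ∉ U 1 := hnot (by decide) hy
        have h2 : y ∉ U 2 := hnot (by decide) hy
        have h0 : y ∈ U 0 := hy
        simp [f₃, f₂, f₁, h0, h1, h2, hxf]
      · have h2 : y ∉ U 2 := hnot (by decide) hy
        have h1 : y ∈ U 1 := hy
        simp [f₃, f₂, f₁, h1, h2, h10, hxf]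
      · have h2 : y ∈ U 2 := hy
        simp [f₃, f₂, f₁, h2, h20, h21, hxf]
    · simp [f₃, f₂, f₁, hvU]
    · exact (sum_cut_ite_le G f₂ (hcutU 2) (huniv 2) (hxU 2)).trans
        ((sum_cut_ite_le G f₁ (hcutU 1) (huniv 1) (hxU 1)).trans
          (sum_cut_ite_le G f (hcutU 0) (huniv 0) (hxU 0)))
  refine le_trans ?_ hgle
  have hsurj : Function.Surjective σ := Finite.surjective_of_injective hσ
  have hκ (j : Fin 3) : edgeConnectivity G ≤ cut G {y | g y = j} := by
    obtain ⟨i, rfl⟩ := hsurj j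
    obtain ⟨l, hl⟩ := exists_ne i
    refine edgeConnectivity_le_cut G ⟨x i, by simp [hgU i _ (hxU i)]⟩ fun h => hl (hσ ?_)
    have hmem : x l ∈ ({y | g y = σ i} : Finset V) := by
      rw [h]
      exact mem_univ _
    rw [← hgU l _ (hxU l)]
    simpa using hmem
  obtain ⟨i₀, hi₀⟩ := hsurj (f v)
  have hdiff : ({y | g y = f v} : Finset V) \ U i₀ = {v} := by
    ext y
    rw [mem_sdiff, mem_filter, mem_singleton]
    constructor
    · rintro ⟨⟨-, hy⟩, hy'⟩
      rcases hcov y with rfl | ⟨i, hi⟩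
      · rfl
      · rw [hgU i y hi, ← hi₀] at hy
        rw [hσ hy] at hi
        exact absurd hi hy'
    · rintro rfl
      exact ⟨⟨mem_univ _, hgv⟩, hvU i₀⟩
  have h1 := cut_sdiff_add_cut_sdiff_le G {y | g y = f v} (U i₀)
  rw [hdiff, hcutU] at h1
  have h2 := card_mul_succ_minDegree_le G {v}
  rw [card_singleton] at h2
  have h3 : 2 * edgeConnectivity G ≤ ∑ j ∈ univ.erase (f v), cut G {y | g y = j} := by
    have h4 := card_nsmul_le_sum (univ.erase (f v)) (fun j => cut G {y | g y = j})
      (edgeConnectivity G) fun j _ => hκ j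
    simpa using h4
  rw [← add_sum_erase univ _ (mem_univ (f v))]
  omega

/-- Under the absence of four small cuts, the graphs in the class satisfy the partition
condition for `k + 1` disjoint spanning trees. -/
theorem NoFourSmallCuts.succ_mul_le (h : NoFourSmallCuts G k δ) (hG : InClass 2 G)
    (hmin : G.minDegree = δ) (hδ : 3 * k + 3 ≤ δ) (s : ℕ) (f : V → Fin s)
    (hf : Function.Surjective f) :
    (k + 1) * s ≤ (crossing G f).edgeSet.ncard + (k + 1) := by
  obtain ⟨U, hne, huniv, hU, hW, hcut⟩ := hG
  have hcutU (i : Fin 3) : cut G (U i) = edgeConnectivity G := (hcut i).symm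
  rcases Nat.lt_or_ge s 2 with hs | hs
  · nlinarith
  have h2 := two_mul_ncard_crossing G f
  have hPne (j : Fin s) : ({x | f x = j} : Finset V).Nonempty := by
    obtain ⟨x, hx⟩ := hf j
    exact ⟨x, by simp [hx]⟩
  have hκP (j : Fin s) : edgeConnectivity G ≤ cut G {x | f x = j} := by
    have : Nontrivial (Fin s) := Fin.nontrivial_iff_two_le.2 hs
    refine edgeConnectivity_le_cut G (hPne j) fun huniv => ?_
    obtain ⟨l, hl⟩ := exists_ne j
    obtain ⟨x, hx⟩ := hf l
    have hmem : x ∈ ({x | f x = j} : Finset V) := by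
      rw [huniv]
      exact mem_univ x
    rw [mem_filter, hx] at hmem
    exact hl hmem.2
  set κ := edgeConnectivity G with hκdef
  rcases Nat.lt_or_ge κ (2 * k + 2) with hκ | hκ
  swap
  · have h3 := card_nsmul_le_sum univ (fun j => cut G {x | f x = j}) (2 * k + 2)
      fun j _ => hκ.trans (hκP j)
    rw [← h2, card_univ, Fintype.card_fin, smul_eq_mul] at h3
    nlinarith
  have hlarge {X : Finset V} (hX : X.Nonempty) (hX' : cut G X ≤ 3 * k + 2) : δ < #X := by
    rw [← hmin]
    exact minDegree_lt_card_of_cut_lt hX (by omega)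
  have hcardU (i : Fin 3) : δ ≤ #(U i) := by
    rw [← hmin]
    exact (minDegree_lt_card_of_cut_lt (hne i) (by rw [hcutU i]; omega)).le
  -- the vertices outside the three minimum cuts
  have hW' : (univ.biUnion U)ᶜ.Nonempty := by rwa [compl_eq_univ_sdiff]
  have hWcard : #(univ.biUnion U)ᶜ < δ :=
    h.card_compl_lt U hU hcardU fun i => by rw [hcutU i]; omega
  have hWcut : cut G (univ.biUnion U)ᶜ ≤ 3 * κ := by
    rw [cut_compl]
    refine (cut_biUnion_le G _ _).trans (le_of_eq ?_)
    simp [hcutU]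
  have hWone : #(univ.biUnion U)ᶜ = 1 :=
    card_eq_one_of_cut_add_two_lt (G := G) hW' (by omega) (by omega)
  have hκδ : δ ≤ 3 * κ := by
    have h3 := card_mul_succ_minDegree_le G (univ.biUnion U)ᶜ
    rw [hWone] at h3
    omega
  obtain ⟨v, hv⟩ := card_eq_one.1 hWone
  -- at most three parts have small cuts
  set T : Finset (Fin s) := {j | cut G {x | f x = j} ≤ 3 * k + 2} with hT
  have hTcard : #T ≤ 3 := by
    by_contra! hlt
    obtain ⟨T', hT', hT'card⟩ := exists_subset_card_eq (Nat.succ_le_of_lt hlt)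
    let e := T'.equivFinOfCardEq hT'card
    have hcutT (i : Fin 4) : cut G {x | f x = (e.symm i : Fin s)} ≤ 3 * k + 2 := by
      have := hT' (e.symm i).2
      rw [hT, mem_filter] at this
      exact this.2
    obtain ⟨i, hi⟩ := h.exists_lt_cut (fun i => {x | f x = (e.symm i : Fin s)})
      (fun i j hij => by
        rw [disjoint_left]
        intro x hx hx'
        rw [mem_filter] at hx hx'
        exact hij (e.symm.injective (Subtype.ext (hx.2.symm.trans hx'.2))))
      (fun i => (hlarge (hPne _) (hcutT i)).le)
    have := hcutT i
    omega
  -- every part has a cut of at least `κ ≥ k + 1` edges, and at least `3 k + 3` if it is not in `T`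
  have hsum : #T * (k + 1) + (s - #T) * (3 * k + 3) ≤ ∑ j, cut G {x | f x = j} := by
    rw [← sum_filter_add_sum_filter_not univ (fun j => cut G {x | f x = j} ≤ 3 * k + 2), ← hT]
    refine Nat.add_le_add ?_ ?_
    · rw [← smul_eq_mul]
      exact card_nsmul_le_sum _ _ _ fun j _ => le_trans (by omega) (hκP j)
    · have h3 : #({j | ¬ cut G {x | f x = j} ≤ 3 * k + 2} : Finset (Fin s)) = s - #T := by
        rw [hT, filter_not, card_sdiff_of_subset (filter_subset _ _), card_univ, Fintype.card_fin]
      rw [← h3, ← smul_eq_mul]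
      refine card_nsmul_le_sum _ _ _ fun j hj => ?_
      rw [mem_filter] at hj
      omega
  rw [← h2] at hsum
  have hTs : #T ≤ s := (card_le_univ T).trans_eq (Fintype.card_fin s)
  obtain ⟨r, hr⟩ := Nat.exists_eq_add_of_le hTs
  have hr' : s - #T = r := by omega
  rw [hr'] at hsum
  by_cases hexc : #T = 3 ∧ r = 0
  swap
  · have hk1 : 3 * k + 3 = 3 * (k + 1) := by ring
    have hmul : (k + 1) * s = #T * (k + 1) + r * (k + 1) := by
      rw [← add_mul, ← hr, mul_comm]
    rw [hk1] at hsum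
    rw [hmul]
    rcases (by omega : #T ≤ 2 ∨ 1 ≤ r) with h3 | h3
    · nlinarith [Nat.mul_le_mul_right (k + 1) h3, Nat.zero_le (r * (k + 1))]
    · nlinarith [Nat.mul_le_mul_right (k + 1) h3, Nat.mul_le_mul_right (k + 1) hTcard]
  -- three parts, all with small cuts
  obtain ⟨hT3, rfl⟩ := hexc
  obtain rfl : s = 3 := by omega
  have hTu : T = univ := (card_eq_iff_eq_univ T).1 hT3
  have hcutP (j : Fin 3) : cut G {x | f x = j} ≤ 3 * k + 2 := by
    have : j ∈ T := by
      rw [hTu]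
      exact mem_univ j
    rw [hT, mem_filter] at this
    exact this.2
  obtain ⟨σ, hσ, hσf⟩ := h.exists_injective (by omega) hne hU hcardU
    (fun i => by rw [hcutU i]; omega) hv (fun j => hlarge (hPne j) (hcutP j))
    (fun j => (hcutP j).trans (by omega))
  have h3 := minDegree_add_edgeConnectivity_le_sum_cut huniv hU hcutU hv hσ hσf
  rw [← h2] at h3
  omega

/-! ### From eigenvalue bounds to spanning trees -/

/-- The Laplacian bound obtained from weighted cuts of at most `8 k + 4` edges and sets of at least
`δ` vertices is below the gap in the eigenvalue conditions. -/
theorem le_nine_mul_div {k δ m : ℕ} (hδ : 3 * k + 3 ≤ δ) (hm : δ ≤ m) :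
    8 * (k : ℝ) + 4 ≤ 9 * ((k : ℝ) + ((δ : ℝ) - 1) / δ) / ((δ : ℝ) + 1) * m := by
  have hδ0 : (0 : ℝ) < δ := by
    have : 0 < δ := by omega
    exact_mod_cast this
  have hδ' : 3 * (k : ℝ) + 3 ≤ δ := by exact_mod_cast hδ
  have hm' : (δ : ℝ) ≤ m := by exact_mod_cast hm
  have hk0 : (0 : ℝ) ≤ k := Nat.cast_nonneg k
  have h1 : 9 * ((k : ℝ) + ((δ : ℝ) - 1) / δ) / ((δ : ℝ) + 1) =
      9 * (k * δ + (δ - 1)) / (δ * (δ + 1)) := by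
    field_simp
  have h2 : 8 * (k : ℝ) + 4 ≤ 9 * (k * δ + (δ - 1)) / (δ * (δ + 1)) * δ := by
    have h3 : 9 * (k * (δ : ℝ) + (δ - 1)) / (δ * (δ + 1)) * δ =
        9 * (k * δ + (δ - 1)) / (δ + 1) := by
      field_simp
    rw [h3, le_div_iff₀ (by positivity)]
    nlinarith [mul_nonneg hk0 (sub_nonneg.2 hδ')]
  rw [h1]
  refine h2.trans (mul_le_mul_of_nonneg_left hm' (div_nonneg ?_ (by positivity)))
  nlinarith [mul_nonneg hk0 hδ0.le]

theorem laplacian_le_of_cut_le (hδ : 3 * k + 3 ≤ δ) {U : Fin 4 → Finset V} {p : Fin 4 → ℝ}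
    (hU : ∀ i j, i ≠ j → Disjoint (U i) (U j)) (hcard : ∀ i, δ ≤ #(U i)) (hp : ∀ i, 0 < p i)
    (hp' : ∀ i j, i ≠ j → p i + p j ≤ p i * p j)
    (hcut : ∀ i, p i * cut G (U i) ≤ 8 * (k : ℝ) + 4) (c : Fin 4 → ℝ) :
    (∑ u, ∑ v, if G.Adj u v then ((∑ l, c l • indicatorVec (U l)) u -
      (∑ l, c l • indicatorVec (U l)) v) ^ 2 else 0) / 2 ≤
    9 * ((k : ℝ) + ((δ : ℝ) - 1) / δ) / ((δ : ℝ) + 1) *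
      ((∑ l, c l • indicatorVec (U l)) ⬝ᵥ (∑ l, c l • indicatorVec (U l))) := by
  refine (laplacian_sum_smul_indicatorVec_le G hU hp hp' c).trans ?_
  rw [sum_smul_indicatorVec_dotProduct_self hU, mul_sum]
  refine sum_le_sum fun i _ => ?_
  rw [← mul_assoc]
  exact mul_le_mul_of_nonneg_right ((hcut i).trans (le_nine_mul_div hδ (hcard i))) (sq_nonneg _)

theorem card_le_card_of_disjoint {U : Fin 4 → Finset V}
    (hU : ∀ i j, i ≠ j → Disjoint (U i) (U j)) (hne : ∀ i, (U i).Nonempty) :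
    4 ≤ Fintype.card V := by
  have := (linearIndependent_indicatorVec hU hne).fintype_card_le_finrank
  simpa using this

theorem noFourSmallCuts_of_pos (hmin : G.minDegree = δ) (hδ : 3 * k + 3 ≤ δ) {a b : ℝ} (hb : 0 < b)
    (hab : -1 ≤ a / b)
    (hlt : nthLargestEigenvalue (a • G.degMatrix ℝ + b • G.adjMatrix ℝ) 4
      < (a + b) * δ - 9 * b * ((k : ℝ) + ((δ : ℝ) - 1) / δ) / ((δ : ℝ) + 1)) :
    NoFourSmallCuts G k δ := by
  intro U p hU hcard hp hp'
  by_contra! hcut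
  have hne (i : Fin 4) : (U i).Nonempty := card_pos.1 (lt_of_lt_of_le (by omega) (hcard i))
  have hab' : 0 ≤ a + b := by
    rw [le_div_iff₀ hb] at hab
    linarith
  refine absurd (le_nthLargestEigenvalue (isHermitian_smul_degMatrix_add G a b) (by norm_num)
    (card_le_card_of_disjoint hU hne) (fun i => indicatorVec (U i))
    (linearIndependent_indicatorVec hU hne) fun c => ?_) (not_le.2 hlt)
  rw [dotProduct_mulVec_degMatrix_add_adjMatrix]
  have h1 := mul_le_mul_of_nonneg_left (laplacian_le_of_cut_le hδ hU hcard hp hp' hcut c) hb.le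
  have h2 := mul_le_mul_of_nonneg_left
    (minDegree_mul_dotProduct_self_le G (∑ l, c l • indicatorVec (U l))) hab'
  rw [hmin] at h2
  refine le_trans (le_of_eq ?_) (sub_le_sub h2 h1)
  ring

theorem noFourSmallCuts_of_neg (hmin : G.minDegree = δ) (hδ : 3 * k + 3 ≤ δ) {a b : ℝ} (hb : b < 0)
    (hab : -1 ≤ a / b)
    (hlt : nthLargestEigenvalue (a • G.degMatrix ℝ + b • G.adjMatrix ℝ) (Fintype.card V - 3)
      > (a + b) * δ - 9 * b * ((k : ℝ) + ((δ : ℝ) - 1) / δ) / ((δ : ℝ) + 1)) :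
    NoFourSmallCuts G k δ := by
  intro U p hU hcard hp hp'
  by_contra! hcut
  have hne (i : Fin 4) : (U i).Nonempty := card_pos.1 (lt_of_lt_of_le (by omega) (hcard i))
  have h4 := card_le_card_of_disjoint hU hne
  have hab' : a + b ≤ 0 := by
    rw [le_div_iff_of_neg hb] at hab
    linarith
  refine absurd (nthLargestEigenvalue_le (isHermitian_smul_degMatrix_add G a b) (by omega)
    (by norm_num) (by omega : Fintype.card V - 3 + 4 = Fintype.card V + 1)
    (fun i => indicatorVec (U i)) (linearIndependent_indicatorVec hU hne) fun c => ?_)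
    (not_le.2 hlt)
  rw [dotProduct_mulVec_degMatrix_add_adjMatrix]
  have h1 := mul_le_mul_of_nonpos_left (laplacian_le_of_cut_le hδ hU hcard hp hp' hcut c) hb.le
  have h2 := mul_le_mul_of_nonpos_left
    (minDegree_mul_dotProduct_self_le G (∑ l, c l • indicatorVec (U l))) hab'
  rw [hmin] at h2
  refine (sub_le_sub h2 h1).trans (le_of_eq ?_)
  ring

theorem NoFourSmallCuts.propertyP (h : NoFourSmallCuts G k δ) (hG : InClass 2 G)
    (hmin : G.minDegree = δ) (hδ : 3 * k + 3 ≤ δ) : PropertyP k δ G := by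
  have hcard : 1 < Fintype.card V := by
    obtain ⟨U, hne, huniv, -⟩ := hG
    have h1 := (card_lt_iff_ne_univ (U 0)).2 (huniv 0)
    have h2 := (hne 0).card_pos
    omega
  have : Nonempty V := Fintype.card_pos_iff.1 (by omega)
  obtain ⟨T, hT, hdisj⟩ := exists_disjoint_spanning_trees G (k + 1)
    (h.succ_mul_le hG hmin hδ)
  -- the last of the `k + 1` trees serves as the forest
  refine ⟨fun i => T i.castSucc, T (Fin.last k), fun i => hT _,
    fun i j hij => hdisj _ _ fun h => hij (Fin.castSucc_injective k h), (hT _).1,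
    (hT _).2.isAcyclic, fun i => hdisj _ _ (Fin.castSucc_lt_last i).ne, ?_,
    fun hF => absurd (hT _).2 hF⟩
  have hedges := (SimpleGraph.isTree_iff_connected_and_card.1 (hT (Fin.last k)).2).2
  rw [Nat.card_coe_set_eq, Nat.card_eq_fintype_card] at hedges
  have hedges' : ((T (Fin.last k)).edgeSet.ncard : ℝ) = (Fintype.card V : ℝ) - 1 := by
    rw [← hedges]
    push_cast
    ring
  rw [hedges']
  have hδ0 : (0 : ℝ) < δ := by
    have : 0 < δ := by omega
    exact_mod_cast this
  have hn : (0 : ℝ) < (Fintype.card V : ℝ) - 1 := by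
    rw [sub_pos]
    exact_mod_cast hcard
  have hfrac : ((δ : ℝ) - 1) / δ < 1 := by
    rw [div_lt_one hδ0]
    linarith
  nlinarith

end Partition

end TreePacking

theorem corollary4p2 {V : Type*} [Fintype V] [DecidableEq V]
    (G : SimpleGraph V) [DecidableRel G.Adj] (k δ : ℕ) (hk : 2 ≤ k)
    (hG : TreePacking.InClass 2 G) (hmin : G.minDegree = δ) (hδ : 3 * k + 3 ≤ δ) :
    (∀ a : ℝ, -1 ≤ a →
      TreePacking.nthLargestEigenvalue (a • G.degMatrix ℝ + G.adjMatrix ℝ) 4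
        < (a + 1) * δ - 9 * ((k : ℝ) + ((δ : ℝ) - 1) / δ) / ((δ : ℝ) + 1) →
      TreePacking.PropertyP k δ G) ∧
    (∀ a b : ℝ, 0 < b → -1 ≤ a / b →
      TreePacking.nthLargestEigenvalue (a • G.degMatrix ℝ + b • G.adjMatrix ℝ) 4
        < (a + b) * δ - 9 * b * ((k : ℝ) + ((δ : ℝ) - 1) / δ) / ((δ : ℝ) + 1) →
      TreePacking.PropertyP k δ G) ∧
    (∀ a b : ℝ, b < 0 → -1 ≤ a / b →
      TreePacking.nthLargestEigenvalue (a • G.degMatrix ℝ + b • G.adjMatrix ℝ)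
          (Fintype.card V - 3)
        > (a + b) * δ - 9 * b * ((k : ℝ) + ((δ : ℝ) - 1) / δ) / ((δ : ℝ) + 1) →
      TreePacking.PropertyP k δ G) := by
  refine ⟨fun a ha h => ?_, fun a b hb hab h => ?_, fun a b hb hab h => ?_⟩
  · refine (TreePacking.noFourSmallCuts_of_pos (a := a) hmin hδ one_pos (by rwa [div_one])
      ?_).propertyP hG hmin hδ
    rwa [one_smul, mul_one]
  · exact (TreePacking.noFourSmallCuts_of_pos hmin hδ hb hab h).propertyP hG hmin hδ
  · exact (TreePacking.noFourSmallCuts_of_neg hmin hδ hb hab h).propertyP hG hmin hδ
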